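/- Let $U=(1,1)$ and $D_k=(1,-k)$ for $k\ge 1$. A Dyck path with air pockets is a non-empty lattice path in the first quadrant of $\mathbb{Z}^2$ that starts at the origin, ends on the $x$-axis, and consists of steps $U$ and $D_k$ ($k\ge1$), no two down-steps being consecutive. Its length is its number of steps, and $\mathcal{A}_n$ denotes the (finite) set of Dyck paths with air pockets of length $n$. For $k\ge 1$, a $k$-pyramid in a path is an occurrence of the pattern $U^kD_k$ as a block of consecutive steps, and the popularity $\mathbf{\Delta}_k(\mathcal{A}_n)$ is the total number of $k$-pyramids in all the paths of $\mathcal{A}_n$. (i) For every $k\ge 1$, $$\sum_{n\ge 0}\mathbf{\Delta}_k(\mathcal{A}_n)\,x^n=\frac{x^{k+1}\left(1+2x^2-x^3+(1-x)\sqrt{(x^2+x+1)(x^2-3x+1)}\right)}{2\sqrt{(x^2+x+1)(x^2-3x+1)}}$$ as formal power series, where the square root is the one with constant term $1$. (ii) For all $k\ge 1$ and $n\ge 2$, $\mathbf{\Delta}_1(\mathcal{A}_n)=\mathbf{\Delta}_k(\mathcal{A}_{n+k-1})$. (iii) For every fixed $k\ge 1$, as $n\to\infty$, $$\mathbf{\Delta}_k(\mathcal{A}_n)\sim\frac{\sqrt5-1}{2\sqrt{\pi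 n}\,\sqrt{14\sqrt5-30}}\left(\frac{3+\sqrt5}{2}\right)^{n-k-1}.$$ -/

import Mathlib

namespace AirPockets

/-- The steps of the lattice paths: the up-step `U = (1, 1)` and the down-steps `D k = (1, -k)`.
The constraint `1 ≤ k` is part of `IsDyckPath`. -/
inductive Step : Type
  | U : Step
  | D (k : ℕ) : Step
  deriving DecidableEq

/-- The vertical component of a step. -/
def Step.rise : Step → ℤ
  | Step.U => 1
  | Step.D k => -(k : ℤ)

/-- Being a down-step. -/
def Step.IsDown (s : Step) : Prop := ∃ k : ℕ, s = Step.D k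

/-- The ordinate of the endpoint of a path that starts at the origin. -/
def height (p : List Step) : ℤ := (p.map Step.rise).sum

/-- Dyck paths with air pockets. -/
structure IsDyckPath (p : List Step) : Prop where
  nonempty : p ≠ []
  down_pos : ∀ k : ℕ, Step.D k ∈ p → 1 ≤ k
  height_nonneg : ∀ q : List Step, q <+: p → 0 ≤ height q
  height_eq_zero : height p = 0
  no_consecutive_downs : p.IsChain (fun s t => ¬ (s.IsDown ∧ t.IsDown))

/-- The set `𝒜_n` of Dyck paths with air pockets of length (number of steps) `n`. -/
def paths (n : ℕ) : Set (List Step) := {p | p.length = n ∧ IsDyckPath p}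

theorem height_le_length (p : List Step) : height p ≤ p.length := by
  induction p with
  | nil => simp [height]
  | cons s p ih =>
    have hs : s.rise ≤ 1 := by cases s <;> simp [Step.rise]
    simp only [height, List.map_cons, List.sum_cons, List.length_cons] at ih ⊢
    push_cast
    linarith

theorem down_le_length {p : List Step} (hp : IsDyckPath p) {k : ℕ} (hk : Step.D k ∈ p) :
    k ≤ p.length := by
  obtain ⟨s, t, rfl⟩ := List.append_of_mem hk
  have h := hp.height_nonneg (s ++ [Step.D k]) ⟨t, by simp⟩
  have hs := height_le_length s
  simp only [height, List.map_append, List.sum_append, List.map_cons, List.map_nil,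
    List.sum_cons, List.sum_nil, Step.rise] at h hs
  simp only [List.length_append, List.length_cons]
  omega

theorem paths_finite (n : ℕ) : (paths n).Finite := by
  let f : Option (Fin (n + 1)) → Step := fun o => o.elim Step.U (fun i => Step.D i)
  refine ((List.finite_length_eq (Option (Fin (n + 1))) n).image (List.map f)).subset ?_
  rintro p ⟨hl, hp⟩
  have hmem : ∀ s ∈ p, s ∈ Set.range f := by
    intro s hs
    cases s with
    | U => exact ⟨none, rfl⟩
    | D k => exact ⟨some ⟨k, by have := down_le_length hp hs; omega⟩, rfl⟩
  obtain ⟨l, rfl⟩ : p ∈ Set.range (List.map f) := by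
    rw [Set.range_list_map]
    exact hmem
  exact ⟨l, by simpa using hl, rfl⟩

/-- The number of occurrences of the pattern `w` as a block of consecutive steps of `p`
(the number of starting positions, that is, of suffixes of `p` that begin with `w`). -/
def occurrences (w p : List Step) : ℕ := p.tails.countP (fun t => w <+: t)

/-- The pattern `U^k D_k`. -/
def pyramid (k : ℕ) : List Step := List.replicate k Step.U ++ [Step.D k]

/-- The popularity of the pattern `w` in `𝒜_n`: its total number of occurrences. -/
noncomputable def popularity (w : List Step) (n : ℕ) : ℕ :=
  ∑ p ∈ (paths_finite n).toFinset, occurrences w p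

/-- The generating function of the popularity of `k`-pyramids. -/
noncomputable def pyramidGF (k : ℕ) : PowerSeries ℝ :=
  PowerSeries.mk (fun n => (popularity (pyramid k) n : ℝ))

end AirPockets

open AirPockets PowerSeries Filter Asymptotics

namespace AirPockets

/-
Removing a `k`-pyramid from a path of length `n` leaves a path of length `n - k - 1` together with a
marked place that is not followed by a down-step, and conversely. A path with `u` up-steps has
`1 + u` such places, whatever `k` is; hence the popularity of `k`-pyramids depends only on
`n - k - 1`, and its generating function is `x ^ (k + 1)` times that of `1 + u` over all paths.
A nonempty path is a prefix that does not end with a down-step, completed by the down-step to the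
axis, and such a prefix factors at its last departure from the axis. This gives a quadratic equation
for the generating function of the paths and a linear one for the weight `1 + u`.
For the asymptotics, the only singularity of smallest modulus is the root `ρ` of `x² - 3x + 1`,
where the generating function is `(1 - x / ρ) ^ (-1 / 2)` times a function analytic in a larger
disc, up to a polynomial; Bender's theorem transfers the coefficients of the first factor.
-/
open Finset.HasAntidiagonal (antidiagonal mem_antidiagonal)
open scoped Topology

/-- The path `p` ends with a down-step. -/
def EndsDown (p : List Step) : Prop := ∃ k, p.getLast? = some (Step.D k)

/-- The path `p` starts with a down-step. -/
def StartsDown (p : List Step) : Prop := ∃ k, p.head? = some (Step.D k)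

/-- A path with air pockets that starts at ordinate `h`, stays weakly above the `x`-axis and may end
anywhere; for `h = 0` these are the prefixes of Dyck paths with air pockets. -/
structure IsPathFrom (h : ℤ) (p : List Step) : Prop where
  down_pos : ∀ k : ℕ, Step.D k ∈ p → 1 ≤ k
  nonneg : ∀ q : List Step, q <+: p → 0 ≤ h + height q
  no_consecutive_downs : p.IsChain (fun s t => ¬ (s.IsDown ∧ t.IsDown))

@[simp] theorem height_nil : height [] = 0 := rfl

@[simp] theorem height_U_cons (p : List Step) : height (Step.U :: p) = 1 + height p := by
  simp [height, Step.rise]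

@[simp] theorem height_D_cons (k : ℕ) (p : List Step) :
    height (Step.D k :: p) = -k + height p := by
  simp [height, Step.rise]

@[simp] theorem height_append (p q : List Step) : height (p ++ q) = height p + height q := by
  simp [height]

@[simp] theorem height_pyramid (k : ℕ) : height (pyramid k) = 0 := by
  simp [pyramid, height, Step.rise]

@[simp] theorem not_endsDown_nil : ¬ EndsDown [] := by simp [EndsDown]

@[simp] theorem not_startsDown_nil : ¬ StartsDown [] := by simp [StartsDown]

@[simp] theorem not_startsDown_U_cons (p : List Step) : ¬ StartsDown (Step.U :: p) := by
  simp [StartsDown]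

@[simp] theorem startsDown_D_cons (k : ℕ) (p : List Step) : StartsDown (Step.D k :: p) :=
  ⟨k, rfl⟩

@[simp] theorem endsDown_concat_D (p : List Step) (k : ℕ) : EndsDown (p ++ [Step.D k]) :=
  ⟨k, by simp⟩

@[simp] theorem endsDown_append_U_cons {p q : List Step} :
    EndsDown (p ++ Step.U :: q) ↔ EndsDown q := by
  cases q using List.reverseRecOn <;> simp [EndsDown, List.getLast?_append, List.getLast?_cons]

theorem IsPathFrom.height_nonneg {h : ℤ} {p : List Step} (hp : IsPathFrom h p) :
    0 ≤ h + height p :=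
  hp.nonneg p (List.prefix_refl p)

theorem IsPathFrom.start_nonneg {h : ℤ} {p : List Step} (hp : IsPathFrom h p) : 0 ≤ h := by
  simpa using hp.nonneg [] p.nil_prefix

theorem IsPathFrom.mono {h h' : ℤ} {p : List Step} (hp : IsPathFrom h p) (hh : h ≤ h') :
    IsPathFrom h' p :=
  ⟨hp.down_pos, fun q hq => (hp.nonneg q hq).trans (by gcongr), hp.no_consecutive_downs⟩

theorem isPathFrom_append {h : ℤ} {p q : List Step} :
    IsPathFrom h (p ++ q) ↔
      IsPathFrom h p ∧ IsPathFrom (h + height p) q ∧ ¬ (EndsDown p ∧ StartsDown q) := by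
  have junction : (∀ s ∈ p.getLast?, ∀ t ∈ q.head?, ¬ (s.IsDown ∧ t.IsDown)) ↔
      ¬ (EndsDown p ∧ StartsDown q) := by
    simp only [Option.mem_def, Step.IsDown, EndsDown, StartsDown]
    grind
  constructor
  · rintro ⟨hd, hn, hc⟩
    rw [List.isChain_append, junction] at hc
    refine ⟨⟨fun k hk => hd k (List.mem_append_left q hk),
      fun r hr => hn r (hr.trans (p.prefix_append q)), hc.1⟩,
      ⟨fun k hk => hd k (List.mem_append_right p hk), fun r hr => ?_, hc.2.1⟩, hc.2.2⟩
    simpa [add_assoc] using hn (p ++ r) ((List.prefix_append_right_inj p).2 hr)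
  · rintro ⟨hp, hq, hpq⟩
    refine ⟨fun k hk => (List.mem_append.1 hk).elim (hp.down_pos k) (hq.down_pos k),
      fun r hr => ?_, ?_⟩
    · obtain ⟨s, hs⟩ := hr
      rcases List.append_eq_append_iff.1 hs with ⟨t, rfl, -⟩ | ⟨t, rfl, rfl⟩
      · exact hp.nonneg r (r.prefix_append t)
      · simpa [add_assoc] using hq.nonneg t (t.prefix_append s)
    · rw [List.isChain_append, junction]
      exact ⟨hp.no_consecutive_downs, hq.no_consecutive_downs, hpq⟩

@[simp] theorem isPathFrom_nil {h : ℤ} : IsPathFrom h [] ↔ 0 ≤ h :=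
  ⟨IsPathFrom.start_nonneg, fun hh => ⟨by simp, by simpa using hh, by simp⟩⟩

@[simp] theorem isPathFrom_U_singleton {h : ℤ} : IsPathFrom h [Step.U] ↔ 0 ≤ h := by
  refine ⟨IsPathFrom.start_nonneg, fun hh => ⟨by simp, fun q hq => ?_, by simp⟩⟩
  rcases List.prefix_cons_iff.1 hq with rfl | ⟨t, rfl, ht⟩
  · simpa using hh
  · simp only [List.prefix_nil.1 ht, height_U_cons, height_nil]
    omega

@[simp] theorem isPathFrom_D_singleton {h : ℤ} {k : ℕ} :
    IsPathFrom h [Step.D k] ↔ 1 ≤ k ∧ k ≤ h := by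
  refine ⟨fun hp => ⟨hp.down_pos k (by simp), ?_⟩, fun hk => ⟨by simpa using hk.1, fun q hq => ?_,
    by simp⟩⟩
  · have := hp.height_nonneg
    simp only [height_D_cons, height_nil] at this
    omega
  · rcases List.prefix_cons_iff.1 hq with rfl | ⟨t, rfl, ht⟩
    · simp only [height_nil]
      omega
    · simp only [List.prefix_nil.1 ht, height_D_cons, height_nil]
      omega

theorem isPathFrom_concat_U {h : ℤ} {p : List Step} :
    IsPathFrom h (p ++ [Step.U]) ↔ IsPathFrom h p := by
  rw [isPathFrom_append, isPathFrom_U_singleton]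
  simpa using IsPathFrom.height_nonneg

theorem isPathFrom_concat_D {h : ℤ} {p : List Step} {k : ℕ} :
    IsPathFrom h (p ++ [Step.D k]) ↔
      IsPathFrom h p ∧ 1 ≤ k ∧ k ≤ h + height p ∧ ¬ EndsDown p := by
  simp [isPathFrom_append, and_assoc]

theorem isPathFrom_U_cons {h : ℤ} {p : List Step} :
    IsPathFrom h (Step.U :: p) ↔ 0 ≤ h ∧ IsPathFrom (h + 1) p := by
  rw [← List.singleton_append, isPathFrom_append, isPathFrom_U_singleton]
  simp [EndsDown]

theorem isPathFrom_replicate_U {h : ℤ} {k : ℕ} (hh : 0 ≤ h) :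
    IsPathFrom h (List.replicate k Step.U) := by
  induction k with
  | zero => simpa
  | succ k ih => rwa [List.replicate_succ', isPathFrom_concat_U]

theorem isPathFrom_pyramid {h : ℤ} {k : ℕ} (hk : 1 ≤ k) :
    IsPathFrom h (pyramid k) ↔ 0 ≤ h := by
  refine ⟨IsPathFrom.start_nonneg, fun hh => isPathFrom_concat_D.2
    ⟨isPathFrom_replicate_U hh, hk, by simpa [height, Step.rise] using hh, ?_⟩⟩
  rintro ⟨j, hj⟩
  simpa using List.eq_of_mem_replicate (List.mem_of_getLast? hj)

theorem isDyckPath_iff {p : List Step} :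
    IsDyckPath p ↔ p ≠ [] ∧ IsPathFrom 0 p ∧ height p = 0 :=
  ⟨fun ⟨h1, h2, h3, h4, h5⟩ => ⟨h1, ⟨h2, by simpa using h3, h5⟩, h4⟩,
    fun ⟨h1, ⟨h2, h3, h5⟩, h4⟩ => ⟨h1, h2, by simpa using h3, h4, h5⟩⟩

theorem finite_setOf_isPathFrom_zero (n : ℕ) :
    {p : List Step | p.length = n ∧ IsPathFrom 0 p}.Finite := by
  -- Appending an up-step and the down-step to the axis turns a prefix into a Dyck path.
  refine Set.Finite.of_injOn (f := fun p => p ++ [Step.U] ++ [Step.D (height p + 1).toNat])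
    (fun p hp => ?_) (fun p hp q hq hpq => ?_) (paths_finite (n + 2))
  · have hh := hp.2.height_nonneg
    exact ⟨by simp [hp.1], isDyckPath_iff.2 ⟨by simp, isPathFrom_concat_D.2
      ⟨isPathFrom_concat_U.2 hp.2, by omega, by simp; omega, by simp⟩, by simp; omega⟩⟩
  · simp only [List.append_assoc] at hpq
    exact List.append_inj_left hpq (hp.1.trans hq.1.symm)

/-- The paths with air pockets of length `n` that return to the axis: the members of `𝒜_n` and, for
`n = 0`, the empty path. -/
noncomputable def closedPaths (n : ℕ) : Finset (List Step) :=
  ((finite_setOf_isPathFrom_zero n).sep fun p => height p = 0).toFinset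

/-- The prefixes of length `n` of Dyck paths with air pockets that do not end with a down-step, so
that a down-step may follow. -/
noncomputable def openPaths (n : ℕ) : Finset (List Step) :=
  ((finite_setOf_isPathFrom_zero n).sep fun p => ¬ EndsDown p).toFinset

theorem mem_closedPaths {n : ℕ} {p : List Step} :
    p ∈ closedPaths n ↔ p.length = n ∧ IsPathFrom 0 p ∧ height p = 0 := by
  simp [closedPaths, and_assoc]

theorem mem_openPaths {n : ℕ} {p : List Step} :
    p ∈ openPaths n ↔ p.length = n ∧ IsPathFrom 0 p ∧ ¬ EndsDown p := by
  simp [openPaths, and_assoc]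

theorem closedPaths_zero : closedPaths 0 = {[]} := by
  ext p
  simp +contextual [mem_closedPaths, List.length_eq_zero_iff, iff_def]

theorem openPaths_zero : openPaths 0 = {[]} := by
  ext p
  simp +contextual [mem_openPaths, List.length_eq_zero_iff, iff_def]

theorem closedPaths_one : closedPaths 1 = ∅ := by
  refine Finset.eq_empty_of_forall_notMem fun p hp => ?_
  obtain ⟨hl, hp, hh⟩ := mem_closedPaths.1 hp
  obtain ⟨s, rfl⟩ := List.length_eq_one_iff.1 hl
  cases s with
  | U => simp at hh
  | D k =>
    simp only [isPathFrom_D_singleton, height_D_cons, height_nil] at hp hh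
    omega

theorem one_le_height_of_mem_openPaths {n : ℕ} {p : List Step} (hp : p ∈ openPaths (n + 1)) :
    1 ≤ height p := by
  obtain ⟨hl, hp, hend⟩ := mem_openPaths.1 hp
  rcases p.eq_nil_or_concat' with rfl | ⟨q, s, rfl⟩
  · simp at hl
  · cases s with
    | U =>
      have := (isPathFrom_concat_U.1 hp).height_nonneg
      simp only [height_append, height_U_cons, height_nil] at this ⊢
      omega
    | D k => exact absurd (endsDown_concat_D q k) hend

theorem sum_closedPaths_add_two {M : Type*} [AddCommMonoid M] (f : List Step → M) (n : ℕ) :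
    ∑ p ∈ closedPaths (n + 2), f p =
      ∑ r ∈ openPaths (n + 1), f (r ++ [Step.D (height r).toNat]) := by
  symm
  refine Finset.sum_nbij (fun r => r ++ [Step.D (height r).toNat]) (fun r hr => ?_)
    (fun r _ r' _ h => (List.append_inj' h rfl).1) (fun p hp => ?_) fun _ _ => rfl
  · have hh := one_le_height_of_mem_openPaths hr
    obtain ⟨hl, hr, hend⟩ := mem_openPaths.1 hr
    exact mem_closedPaths.2 ⟨by simp [hl],
      isPathFrom_concat_D.2 ⟨hr, by omega, by omega, hend⟩, by simp; omega⟩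
  · obtain ⟨hl, hp, hh⟩ := mem_closedPaths.1 hp
    rcases p.eq_nil_or_concat' with rfl | ⟨r, s, rfl⟩
    · simp at hl
    · cases s with
      | U =>
        have := (isPathFrom_concat_U.1 hp).height_nonneg
        simp only [height_append, height_U_cons, height_nil] at this hh
        omega
      | D k =>
        obtain ⟨hr, -, -, hend⟩ := isPathFrom_concat_D.1 hp
        have hk : (height r).toNat = k := by
          simp only [height_append, height_D_cons, height_nil] at hh
          omega
        exact ⟨r, mem_openPaths.2 ⟨by simpa using hl, hr, hend⟩, by simp [hk]⟩

theorem exists_last_passage {p : List Step} (hp : IsPathFrom 0 p) (hh : 1 ≤ height p) :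
    ∃ a r, p = a ++ Step.U :: r ∧ height a = 0 ∧ IsPathFrom 0 r := by
  induction p using List.reverseRecOn with
  | nil => simp at hh
  | append_singleton p s ih =>
    cases s with
    | U =>
      rw [isPathFrom_concat_U] at hp
      rcases eq_or_ne (height p) 0 with h0 | h0
      · exact ⟨p, [], by simp, h0, by simp⟩
      · have := hp.height_nonneg
        obtain ⟨a, r, rfl, ha, hr⟩ := ih hp (by omega)
        exact ⟨a, r ++ [Step.U], by simp, ha, isPathFrom_concat_U.2 hr⟩
    | D k =>
      simp only [height_append, height_D_cons, height_nil] at hh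
      obtain ⟨hp, hk, -, hend⟩ := isPathFrom_concat_D.1 hp
      obtain ⟨a, r, rfl, ha, hr⟩ := ih hp (by omega)
      simp only [height_append, ha, height_U_cons, endsDown_append_U_cons] at hh hend
      exact ⟨a, r ++ [Step.D k], by simp, ha, isPathFrom_concat_D.2 ⟨hr, hk, by omega, hend⟩⟩

theorem last_passage_unique {a r a' r' : List Step} (ha : height a = 0) (ha' : height a' = 0)
    (hr : IsPathFrom 0 r) (hr' : IsPathFrom 0 r') (h : a ++ Step.U :: r = a' ++ Step.U :: r') :
    a = a' ∧ r = r' := by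
  wlog hc : ∃ c, a' = a ++ c ∧ Step.U :: r = c ++ Step.U :: r' generalizing a r a' r'
  · rcases List.append_eq_append_iff.1 h with h' | h'
    · exact absurd h' hc
    · exact (this ha' ha hr' hr h.symm h').imp Eq.symm Eq.symm
  obtain ⟨c, rfl, hc⟩ := hc
  cases c with
  | nil => simpa using hc
  | cons s c =>
    obtain ⟨rfl, rfl⟩ := List.cons.inj hc
    have := hr.nonneg c (c.prefix_append _)
    simp only [height_append, ha, height_U_cons, zero_add] at ha'
    omega

theorem sum_openPaths_succ {M : Type*} [AddCommMonoid M] (f : List Step → M) (n : ℕ) :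
    ∑ r ∈ openPaths (n + 1), f r = ∑ ij ∈ antidiagonal n,
      ∑ a ∈ closedPaths ij.1, ∑ b ∈ openPaths ij.2, f (a ++ Step.U :: b) := by
  simp only [← Finset.sum_product']
  rw [Finset.sum_sigma']
  symm
  refine Finset.sum_nbij (fun x => x.2.1 ++ Step.U :: x.2.2) ?_ ?_ ?_ fun _ _ => rfl
  · rintro ⟨ij, a, b⟩ hx
    simp only [Finset.mem_sigma, mem_antidiagonal, Finset.mem_product, mem_closedPaths,
      mem_openPaths] at hx
    obtain ⟨hij, ⟨hal, ha, hah⟩, hbl, hb, hend⟩ := hx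
    exact mem_openPaths.2 ⟨by simp; omega, isPathFrom_append.2
      ⟨ha, isPathFrom_U_cons.2 ⟨by simp [hah], hb.mono (by simp [hah])⟩, by simp⟩, by simpa⟩
  · rintro ⟨⟨i, j⟩, a, b⟩ hx ⟨⟨i', j'⟩, a', b'⟩ hx' h
    simp only [Finset.coe_sigma, Set.mem_sigma_iff, Finset.mem_coe, Finset.mem_product,
      mem_closedPaths, mem_openPaths] at hx hx'
    obtain ⟨-, ⟨rfl, -, ha⟩, rfl, hb, -⟩ := hx
    obtain ⟨-, ⟨rfl, -, ha'⟩, rfl, hb', -⟩ := hx'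
    obtain ⟨rfl, rfl⟩ := last_passage_unique ha ha' hb hb' h
    rfl
  · intro p hp
    obtain ⟨a, r, rfl, ha, hr⟩ :=
      exists_last_passage (mem_openPaths.1 hp).2.1 (one_le_height_of_mem_openPaths hp)
    obtain ⟨hl, hp, hend⟩ := mem_openPaths.1 hp
    refine ⟨⟨(a.length, r.length), a, r⟩, ?_, rfl⟩
    simp only [Finset.coe_sigma, Set.mem_sigma_iff, Finset.mem_coe, mem_antidiagonal,
      Finset.mem_product, mem_closedPaths, mem_openPaths, true_and]
    exact ⟨by simp at hl; omega, ⟨(isPathFrom_append.1 hp).1, ha⟩, hr, by simpa using hend⟩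

section GeneratingFunctions

variable {R : Type*} [CommRing R]

/-- The generating function `∑ n, (∑ p ∈ A n, f p) xⁿ` of the weight `f` over a graded family of
finite sets of paths. -/
noncomputable def weightGF (A : ℕ → Finset (List Step)) (f : List Step → R) : R⟦X⟧ :=
  PowerSeries.mk fun n => ∑ p ∈ A n, f p

/-- The weight `1 + #U`, which counts the places where a pyramid can be inserted. -/
def upsWeight (p : List Step) : R := 1 + p.count Step.U

theorem upsWeight_append_U_cons (a b : List Step) :
    (upsWeight (a ++ Step.U :: b) : R) = upsWeight a + upsWeight b := by
  simp only [upsWeight, List.count_append, List.count_cons_self, Nat.cast_add, Nat.cast_one]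
  ring

theorem weightGF_closedPaths {f : List Step → R} (hf : ∀ r k, f (r ++ [Step.D k]) = f r) :
    weightGF closedPaths f = C (f []) + X * (weightGF openPaths f - C (f [])) := by
  ext n
  match n with
  | 0 => simp [weightGF, closedPaths_zero]
  | 1 => simp [weightGF, closedPaths_one, openPaths_zero, coeff_succ_X_mul 0]
  | n + 2 =>
    rw [map_add, coeff_succ_X_mul]
    simp [weightGF, sum_closedPaths_add_two, hf]

theorem weightGF_openPaths_one :
    weightGF openPaths 1 =
      1 + X * (weightGF closedPaths 1 * weightGF openPaths (1 : List Step → R)) := by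
  ext n
  cases n with
  | zero => simp [weightGF, openPaths_zero]
  | succ n =>
    rw [map_add, coeff_succ_X_mul]
    simp only [coeff_mul, weightGF, coeff_mk, sum_openPaths_succ]
    simp [coeff_one]

theorem weightGF_openPaths_upsWeight :
    weightGF openPaths upsWeight = 1 + X * (weightGF closedPaths upsWeight * weightGF openPaths 1 +
      weightGF closedPaths 1 * weightGF openPaths (upsWeight : List Step → R)) := by
  ext n
  cases n with
  | zero => simp [weightGF, openPaths_zero, upsWeight]
  | succ n =>
    rw [map_add, coeff_succ_X_mul]
    simp only [map_add, coeff_mul, weightGF, coeff_mk, sum_openPaths_succ, Finset.sum_mul_sum,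
      upsWeight_append_U_cons, Finset.sum_add_distrib]
    simp [coeff_one]

theorem weightGF_closedPaths_one_quadratic :
    X * weightGF closedPaths (1 : List Step → R) ^ 2 +
      (X ^ 2 - X - 1) * weightGF closedPaths (1 : List Step → R) + 1 = 0 := by
  have hF := weightGF_closedPaths (f := (1 : List Step → R)) fun _ _ => rfl
  have hO := weightGF_openPaths_one (R := R)
  simp only [Pi.one_apply, map_one] at hF
  linear_combination (X * weightGF closedPaths (1 : List Step → R) - 1) * hF - X * hO

/-- The square root of `(x² + x + 1)(x² - 3x + 1)` with constant term `1`, obtained by solving the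
quadratic equation of the generating function of closed paths. -/
noncomputable def sqrtDisc : R⟦X⟧ := 1 + X - X ^ 2 - 2 * X * weightGF closedPaths 1

theorem sqrtDisc_sq :
    (sqrtDisc : R⟦X⟧) ^ 2 = (X ^ 2 + X + 1) * (X ^ 2 - 3 * X + 1) := by
  rw [sqrtDisc]
  linear_combination 4 * X * weightGF_closedPaths_one_quadratic (R := R)

theorem constantCoeff_sqrtDisc : constantCoeff (sqrtDisc : R⟦X⟧) = 1 := by
  simp [sqrtDisc]

theorem two_mul_sqrtDisc_mul_weightGF_upsWeight :
    2 * sqrtDisc * weightGF closedPaths (upsWeight : List Step → R) =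
      1 + 2 * X ^ 2 - X ^ 3 + (1 - X) * sqrtDisc := by
  have hF := weightGF_closedPaths (f := (1 : List Step → R)) fun _ _ => rfl
  have hG := weightGF_closedPaths (f := (upsWeight : List Step → R)) fun _ _ => by simp [upsWeight]
  have hP := weightGF_openPaths_upsWeight (R := R)
  simp only [Pi.one_apply, upsWeight, List.count_nil, Nat.cast_zero, add_zero, map_one] at hF hG
  rw [sqrtDisc]
  linear_combination 2 * X * hP + 2 * (1 - X * weightGF closedPaths (1 : List Step → R)) * hG -
    2 * X * weightGF closedPaths (upsWeight : List Step → R) * hF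

end GeneratingFunctions

theorem countP_tails {α : Type*} (P : List α → Prop) [DecidablePred P] (p : List α) :
    p.tails.countP (fun t => P t) = {i ∈ Finset.range (p.length + 1) | P (p.drop i)}.card := by
  induction p with
  | nil => simp [List.countP_cons]; split_ifs <;> rfl
  | cons a p ih =>
    rw [List.tails_cons, List.countP_cons, ih, Finset.card_filter, Finset.card_filter,
      List.length_cons, Finset.sum_range_succ' _ (p.length + 1)]
    simp

theorem sum_countP_tails {α : Type*} (P : List α → Prop) [DecidablePred P] (s : Finset (List α)) :
    ∑ p ∈ s, p.tails.countP (fun t => P t) =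
      {x : List α × List α | x.1 ++ x.2 ∈ s ∧ P x.2}.ncard := by
  simp only [countP_tails, ← Finset.card_sigma]
  rw [← Set.ncard_coe_finset]
  refine Set.ncard_congr (fun x _ => (x.1.take x.2, x.1.drop x.2)) ?_ ?_ ?_
  · rintro ⟨p, i⟩ hx
    simp only [Finset.coe_sigma, Finset.coe_filter, Finset.mem_range, Order.lt_add_one_iff,
      Set.mem_sigma_iff, SetLike.mem_coe, Set.mem_ofPred_eq] at hx
    simpa using ⟨hx.1, hx.2.2⟩
  · rintro ⟨p, i⟩ ⟨q, j⟩ hx hy h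
    simp only [Finset.coe_sigma, Finset.coe_filter, Finset.mem_range, Order.lt_add_one_iff,
      Set.mem_sigma_iff, SetLike.mem_coe, Set.mem_ofPred_eq, Prod.mk.injEq] at hx hy h
    obtain rfl : p = q := by rw [← p.take_append_drop i, h.1, h.2, q.take_append_drop]
    obtain rfl : i = j := by
      have := congrArg List.length h.1
      simp only [List.length_take] at this
      omega
    rfl
  · rintro ⟨a, b⟩ hx
    exact ⟨⟨a ++ b, a.length⟩, by simpa [Nat.lt_succ_iff] using hx, by simp⟩

theorem pyramid_ne_nil (k : ℕ) : pyramid k ≠ [] := by simp [pyramid]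

theorem length_pyramid (k : ℕ) : (pyramid k).length = k + 1 := by simp [pyramid]

theorem isPathFrom_insert_pyramid {k : ℕ} (hk : 1 ≤ k) {h : ℤ} {a b : List Step} :
    IsPathFrom h (a ++ (pyramid k ++ b)) ↔ IsPathFrom h (a ++ b) ∧ ¬ StartsDown b := by
  have hend : EndsDown (pyramid k) := endsDown_concat_D _ k
  have hstart : ¬ StartsDown (pyramid k ++ b) := by
    obtain ⟨k, rfl⟩ := Nat.exists_eq_add_of_le' hk
    simp [pyramid, List.replicate_succ]
  simp only [isPathFrom_append, isPathFrom_pyramid hk, height_pyramid, add_zero, hend, hstart,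
    true_and, and_false, not_false_eq_true, and_true]
  exact ⟨fun ⟨ha, _, hb, hs⟩ => ⟨⟨ha, hb, fun hab => hs hab.2⟩, hs⟩,
    fun ⟨⟨ha, hb, _⟩, hs⟩ => ⟨ha, ha.height_nonneg, hb, hs⟩⟩

theorem insert_pyramid_mem_closedPaths {k : ℕ} (hk : 1 ≤ k) {m : ℕ} {a b : List Step} :
    a ++ (pyramid k ++ b) ∈ closedPaths (m + (k + 1)) ↔
      a ++ b ∈ closedPaths m ∧ ¬ StartsDown b := by
  have hlen : a.length + (k + 1 + b.length) = m + (k + 1) ↔ a.length + b.length = m := by omega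
  simp only [mem_closedPaths, isPathFrom_insert_pyramid hk, height_append, height_pyramid,
    List.length_append, length_pyramid, hlen, zero_add]
  tauto

open Classical in
theorem countP_tails_not_startsDown (p : List Step) :
    p.tails.countP (fun t => ¬ StartsDown t) = 1 + p.count Step.U := by
  induction p with
  | nil => simp
  | cons s p ih =>
    rw [List.tails_cons, List.countP_cons, ih]
    cases s <;> simp [add_assoc]

theorem popularity_eq_sum_closedPaths {w : List Step} (hw : w ≠ []) (n : ℕ) :
    popularity w n = ∑ p ∈ closedPaths n, occurrences w p := by
  refine Finset.sum_subset (fun p hp => ?_) fun p hp hp' => ?_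
  · obtain ⟨hl, hp⟩ := (Set.Finite.mem_toFinset _).1 hp
    exact mem_closedPaths.2 ⟨hl, (isDyckPath_iff.1 hp).2⟩
  · obtain ⟨hl, hp⟩ := mem_closedPaths.1 hp
    obtain rfl : p = [] := by
      by_contra hne
      exact hp' ((Set.Finite.mem_toFinset _).2 ⟨hl, isDyckPath_iff.2 ⟨hne, hp⟩⟩)
    simp [occurrences, hw]

theorem popularity_pyramid_add {k : ℕ} (hk : 1 ≤ k) (m : ℕ) :
    popularity (pyramid k) (m + (k + 1)) = ∑ p ∈ closedPaths m, (1 + p.count Step.U) := by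
  classical
  simp only [popularity_eq_sum_closedPaths (pyramid_ne_nil k), occurrences,
    ← countP_tails_not_startsDown]
  rw [sum_countP_tails, sum_countP_tails]
  symm
  refine Set.ncard_congr (fun x _ => (x.1, pyramid k ++ x.2)) ?_ ?_ ?_
  · rintro ⟨a, b⟩ hx
    exact ⟨(insert_pyramid_mem_closedPaths hk).2 hx, List.prefix_append _ _⟩
  · rintro ⟨a, b⟩ ⟨a', b'⟩ - - h
    simpa using h
  · rintro ⟨a, c⟩ ⟨hx, b, rfl⟩
    exact ⟨(a, b), (insert_pyramid_mem_closedPaths hk).1 hx, rfl⟩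

theorem popularity_eq_zero_of_lt_length {w : List Step} {n : ℕ} (hn : n < w.length) :
    popularity w n = 0 := by
  refine Finset.sum_eq_zero fun p hp => List.countP_eq_zero.2 fun t ht hw => ?_
  have hl := ((Set.Finite.mem_toFinset _).1 hp).1
  have htp := ((List.mem_tails _ _).1 ht).length_le
  have hwt := (of_decide_eq_true hw).length_le
  omega

theorem pyramidGF_eq_X_pow_mul {k : ℕ} (hk : 1 ≤ k) :
    pyramidGF k = X ^ (k + 1) * weightGF closedPaths upsWeight := by
  ext n
  rw [coeff_X_pow_mul']
  split_ifs with h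
  · obtain ⟨m, rfl⟩ := Nat.exists_eq_add_of_le' h
    simp [pyramidGF, popularity_pyramid_add hk, weightGF, upsWeight]
  · have hn : n < (pyramid k).length := by rw [length_pyramid]; omega
    simp [pyramidGF, popularity_eq_zero_of_lt_length hn]

theorem pyramidGF_eq {k : ℕ} (hk : 1 ≤ k) :
    pyramidGF k = X ^ (k + 1) * (1 + 2 * X ^ 2 - X ^ 3 + (1 - X) * sqrtDisc) *
      (2 * sqrtDisc)⁻¹ := by
  have h : constantCoeff (2 * sqrtDisc : ℝ⟦X⟧) ≠ 0 := by
    rw [map_mul, constantCoeff_sqrtDisc, map_ofNat]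
    norm_num
  rw [PowerSeries.eq_mul_inv_iff_mul_eq h, pyramidGF_eq_X_pow_mul hk,
    ← two_mul_sqrtDisc_mul_weightGF_upsWeight]
  ring

theorem popularity_pyramid_one_eq {k n : ℕ} (hk : 1 ≤ k) (hn : 2 ≤ n) :
    popularity (pyramid 1) n = popularity (pyramid k) (n + k - 1) := by
  obtain ⟨m, rfl⟩ := Nat.exists_eq_add_of_le' hn
  rw [show m + 2 + k - 1 = m + (k + 1) by omega, popularity_pyramid_add hk,
    popularity_pyramid_add le_rfl]

section PowerSeriesEvaluation

/-- The power series `f` converges at `r` with sum `v`. -/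
def HasSumAt {𝕜 : Type*} [NormedField 𝕜] (f : 𝕜⟦X⟧) (r v : 𝕜) : Prop :=
  HasSum (fun n => coeff n f * r ^ n) v

theorem hasSumAt_coe {𝕜 : Type*} [NormedField 𝕜] (p : Polynomial 𝕜) (r : 𝕜) :
    HasSumAt (p : 𝕜⟦X⟧) r (p.eval r) := by
  simp only [HasSumAt, Polynomial.coeff_coe, Polynomial.eval_eq_sum_range]
  refine hasSum_sum_of_ne_finset_zero fun n hn => ?_
  rw [Polynomial.coeff_eq_zero_of_natDegree_lt (by simpa using hn), zero_mul]

theorem HasSumAt.mul {𝕜 : Type*} [RCLike 𝕜] {f g : 𝕜⟦X⟧} {r v w : 𝕜} (hf : HasSumAt f r v)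
    (hg : HasSumAt g r w) : HasSumAt (f * g) r (v * w) := by
  have hf' := hf.summable.norm
  have hg' := hg.summable.norm
  have hsum := (summable_norm_sum_mul_antidiagonal_of_summable_norm hf' hg').of_norm.hasSum
  rw [← tsum_mul_tsum_eq_tsum_sum_antidiagonal_of_summable_norm hf' hg', hf.tsum_eq,
    hg.tsum_eq] at hsum
  refine hsum.congr_fun fun n => ?_
  rw [coeff_mul, Finset.sum_mul]
  refine Finset.sum_congr rfl fun ij hij => ?_
  rw [← mem_antidiagonal.1 hij, pow_add]
  ring

theorem HasSumAt.rescale {𝕜 : Type*} [NormedField 𝕜] {f : 𝕜⟦X⟧} {a r v : 𝕜}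
    (hf : HasSumAt f (a * r) v) : HasSumAt (PowerSeries.rescale a f) r v := by
  simpa only [HasSumAt, coeff_rescale, mul_pow, mul_left_comm, mul_assoc] using hf

theorem HasSumAt.expand {𝕜 : Type*} [NormedField 𝕜] {f : 𝕜⟦X⟧} {p : ℕ} (hp : p ≠ 0) {r v : 𝕜}
    (hf : HasSumAt f (r ^ p) v) : HasSumAt (PowerSeries.expand p hp f) r v := by
  have hinj : Function.Injective (p * ·) := fun a b h => Nat.eq_of_mul_eq_mul_left
    (Nat.pos_of_ne_zero hp) h
  refine (hinj.hasSum_iff fun n hn => ?_).1 ?_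
  · rw [coeff_expand_of_not_dvd p hp f (fun ⟨m, hm⟩ => hn ⟨m, hm.symm⟩), zero_mul]
  · simpa [HasSumAt, Function.comp_def, pow_mul] using hf

end PowerSeriesEvaluation

section CoefficientAsymptotics

theorem exists_eventually_forall_le_mul {c : ℕ → ℝ} (hpos : ∀ᶠ n in atTop, 0 < c n)
    (hmono : ∀ᶠ n in atTop, c n ≤ c (n + 1)) : ∃ K, ∀ᶠ n in atTop, ∀ m ≤ n, c m ≤ K * c n := by
  obtain ⟨N, hN⟩ := eventually_atTop.1 (hpos.and hmono)
  have mono : ∀ m n, N ≤ m → m ≤ n → c m ≤ c n := fun m n hm hmn => by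
    induction n, hmn using Nat.le_induction with
    | base => rfl
    | succ n hmn ih => exact ih.trans (hN n (hm.trans hmn)).2
  have hcN : 0 < c N := (hN N le_rfl).1
  have hsum : 0 ≤ ∑ j ∈ Finset.range N, |c j| / c N := by positivity
  refine ⟨1 + ∑ j ∈ Finset.range N, |c j| / c N,
    eventually_atTop.2 ⟨N, fun n hn m hm => ?_⟩⟩
  have hcn : 0 < c n := (hN n hn).1
  rcases le_or_gt N m with hNm | hNm
  · nlinarith [mono m n hNm hm]
  · calc c m ≤ |c m| / c N * c N := by rw [div_mul_cancel₀ _ hcN.ne']; exact le_abs_self _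
      _ ≤ (∑ j ∈ Finset.range N, |c j| / c N) * c n := by
          gcongr
          · exact Finset.single_le_sum (f := fun j => |c j| / c N) (fun j _ => by positivity)
              (Finset.mem_range.2 hNm)
          · exact mono N n le_rfl hn
      _ ≤ _ := by nlinarith

variable {𝕜 : Type*} [NormedField 𝕜]

theorem exists_eventually_forall_norm_div_le {b : ℕ → 𝕜} {ρ : 𝕜} {r : ℝ} (hr : ‖ρ‖ < r)
    (hb₀ : ∀ᶠ n in atTop, b n ≠ 0) (hb : Tendsto (fun n => b n / b (n + 1)) atTop (𝓝 ρ)) :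
    ∃ K, ∀ᶠ n in atTop, ∀ j ≤ n, ‖b (n - j) / b n‖ ≤ K * r ^ j := by
  have hr₀ : 0 < r := (norm_nonneg ρ).trans_lt hr
  have hpos : ∀ᶠ n in atTop, 0 < ‖b n‖ * r ^ n := by
    filter_upwards [hb₀] with n hn using by positivity
  have hmono : ∀ᶠ n in atTop, ‖b n‖ * r ^ n ≤ ‖b (n + 1)‖ * r ^ (n + 1) := by
    filter_upwards [hb.norm.eventually_lt_const hr, (tendsto_add_atTop_nat 1).eventually hb₀]
      with n hn hn₀
    rw [norm_div, div_lt_iff₀ (norm_pos_iff.2 hn₀)] at hn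
    rw [pow_succ', ← mul_assoc, mul_comm ‖b (n + 1)‖]
    gcongr
  obtain ⟨K, hK⟩ := exists_eventually_forall_le_mul hpos hmono
  refine ⟨K, ?_⟩
  filter_upwards [hK, hb₀] with n hn hn₀ j hj
  have hbn : 0 < ‖b n‖ := norm_pos_iff.2 hn₀
  rw [norm_div, div_le_iff₀ hbn]
  refine le_of_mul_le_mul_right ((hn (n - j) (Nat.sub_le n j)).trans_eq ?_)
    (pow_pos hr₀ (n - j))
  rw [← Nat.sub_add_cancel hj, pow_add, Nat.sub_add_cancel hj]
  ring

theorem tendsto_sub_div {b : ℕ → 𝕜} {ρ : 𝕜} (hb₀ : ∀ᶠ n in atTop, b n ≠ 0)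
    (hb : Tendsto (fun n => b n / b (n + 1)) atTop (𝓝 ρ)) (j : ℕ) :
    Tendsto (fun n => b (n - j) / b n) atTop (𝓝 (ρ ^ j)) := by
  induction j with
  | zero =>
    refine tendsto_const_nhds.congr' ?_
    filter_upwards [hb₀] with n hn
    simp [hn]
  | succ j ih =>
    rw [pow_succ']
    refine ((hb.comp (tendsto_sub_atTop_nat (j + 1))).mul ih).congr' ?_
    filter_upwards [(tendsto_sub_atTop_nat j).eventually hb₀, eventually_ge_atTop (j + 1)]
      with n hn hj
    rw [Function.comp_apply, show n - (j + 1) + 1 = n - j by omega, div_mul_div_cancel₀ hn]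

/-- Bender's theorem: write the quotient as `∑ j, t_j * (b_{n - j} / b_n)` and apply dominated
convergence. -/
theorem tendsto_coeff_mul_div_coeff [CompleteSpace 𝕜] {B T : 𝕜⟦X⟧} {ρ v : 𝕜} {r : ℝ}
    (hr : ‖ρ‖ < r) (hB₀ : ∀ᶠ n in atTop, coeff n B ≠ 0)
    (hB : Tendsto (fun n => coeff n B / coeff (n + 1) B) atTop (𝓝 ρ))
    (hT : Summable fun n => ‖coeff n T‖ * r ^ n) (hTv : HasSumAt T ρ v) :
    Tendsto (fun n => coeff n (B * T) / coeff n B) atTop (𝓝 v) := by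
  obtain ⟨K, hK⟩ := exists_eventually_forall_norm_div_le hr hB₀ hB
  let term (n j : ℕ) : 𝕜 := if j ≤ n then coeff j T * (coeff (n - j) B / coeff n B) else 0
  have hterm : ∀ n, ∑' j, term n j = coeff n (B * T) / coeff n B := fun n => by
    rw [tsum_eq_sum (s := Finset.range (n + 1)) fun j hj => if_neg (by simpa using hj), mul_comm,
      coeff_mul, Finset.Nat.sum_antidiagonal_eq_sum_range_succ_mk, Finset.sum_div]
    refine Finset.sum_congr rfl fun j hj => ?_
    rw [if_pos (Finset.mem_range_succ_iff.1 hj), mul_div_assoc]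
  simp only [← hterm, ← hTv.tsum_eq]
  refine tendsto_tsum_of_dominated_convergence (hT.mul_left |K|) (fun j => ?_) ?_
  · refine ((tendsto_sub_div hB₀ hB j).const_mul (coeff j T)).congr' ?_
    filter_upwards [eventually_ge_atTop j] with n hn using (if_pos hn).symm
  · have hr₀ : 0 ≤ r := (norm_nonneg ρ).trans hr.le
    filter_upwards [hK] with n hn j
    by_cases hj : j ≤ n
    · calc ‖term n j‖ = ‖coeff j T‖ * ‖coeff (n - j) B / coeff n B‖ := by
            rw [← norm_mul]; exact congrArg norm (if_pos hj)
        _ ≤ ‖coeff j T‖ * (|K| * r ^ j) := by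
            gcongr
            exact (hn j hj).trans (by gcongr; exact le_abs_self K)
        _ = |K| * (‖coeff j T‖ * r ^ j) := by ring
    · simp only [term, if_neg hj, norm_zero]
      positivity

end CoefficientAsymptotics

section BinomialSeries

theorem multichoose_eq_prod_div_factorial (a : ℝ) (n : ℕ) :
    Ring.multichoose a n = (∏ j ∈ Finset.range n, (a + j)) / n.factorial := by
  rw [eq_div_iff (by positivity), mul_comm, ← nsmul_eq_mul,
    Ring.factorial_nsmul_multichoose_eq_ascPochhammer, Polynomial.ascPochhammer_smeval_eq_eval]
  induction n with
  | zero => simp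
  | succ n ih => rw [ascPochhammer_succ_eval, ih, Finset.prod_range_succ]

theorem multichoose_ne_zero {a : ℝ} (ha : ∀ m : ℕ, a ≠ -m) (n : ℕ) : Ring.multichoose a n ≠ 0 := by
  rw [multichoose_eq_prod_div_factorial]
  exact div_ne_zero (Finset.prod_ne_zero_iff.2 fun j _ h => ha j (eq_neg_of_add_eq_zero_left h))
    (by positivity)

theorem tendsto_multichoose_div_succ {a : ℝ} (ha : ∀ m : ℕ, a ≠ -m) :
    Tendsto (fun n : ℕ => Ring.multichoose a n / Ring.multichoose a (n + 1)) atTop (𝓝 1) := by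
  have hlim := tendsto_add_mul_div_add_mul_atTop_nhds 1 a 1 (one_ne_zero (α := ℝ))
  rw [div_one] at hlim
  refine hlim.congr fun n => ?_
  have hprod := multichoose_ne_zero ha n
  have han : a + n ≠ 0 := fun h => ha n (eq_neg_of_add_eq_zero_left h)
  have hsucc : Ring.multichoose a (n + 1) = Ring.multichoose a n * ((a + n) / (n + 1)) := by
    rw [multichoose_eq_prod_div_factorial, multichoose_eq_prod_div_factorial,
      Finset.prod_range_succ, Nat.factorial_succ, Nat.cast_mul, Nat.cast_succ,
      mul_comm ((n : ℝ) + 1), mul_div_mul_comm]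
  rw [hsucc]
  field_simp
  ring

theorem isEquivalent_multichoose {a : ℝ} (ha : ∀ m : ℕ, a ≠ -m) :
    (fun n : ℕ => Ring.multichoose a n) ~[atTop]
      fun n : ℕ => (Real.Gamma a)⁻¹ * (n : ℝ) ^ (a - 1) := by
  have hΓ : (fun n => (Real.GammaSeq a n)⁻¹) ~[atTop] fun _ => (Real.Gamma a)⁻¹ :=
    ((isEquivalent_const_iff_tendsto (Real.Gamma_ne_zero ha)).2 (Real.GammaSeq_tendsto_Gamma a)).inv
  have hn : (fun n : ℕ => (n : ℝ) / (n + a)) ~[atTop] fun _ => 1 :=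
    (isEquivalent_const_iff_tendsto one_ne_zero).2 (tendsto_natCast_div_add_atTop a)
  have hprod := (hΓ.mul (IsEquivalent.refl (u := fun n : ℕ => (n : ℝ) ^ (a - 1)))).mul hn
  refine (hprod.congr_left ?_).congr_right (.of_eq (by ext n; simp))
  filter_upwards [eventually_ne_atTop 0] with n hn
  have hn : (n : ℝ) ≠ 0 := by positivity
  have han : n + a ≠ 0 := fun h => ha n (eq_neg_of_add_eq_zero_right h)
  simp only [Pi.mul_apply, Real.GammaSeq, multichoose_eq_prod_div_factorial,
    Finset.prod_range_succ, Real.rpow_sub_one hn]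
  field_simp
  ring

/-- The binomial series of `(1 - x) ^ a` for a real exponent `a`, obtained from that of
`(1 + x) ^ a` by the substitution of `-x` for `x`. -/
noncomputable def oneSubRPow (a : ℝ) : ℝ⟦X⟧ := rescale (-1) (binomialSeries ℝ a)

theorem oneSubRPow_add (a b : ℝ) : oneSubRPow (a + b) = oneSubRPow a * oneSubRPow b := by
  simp [oneSubRPow, binomialSeries_add]

theorem oneSubRPow_zero : oneSubRPow 0 = 1 := by simp [oneSubRPow]

theorem oneSubRPow_one : oneSubRPow 1 = 1 - X := by
  have h := congrArg (rescale (-1)) (binomialSeries_nat (R := ℝ) (A := ℝ) 1)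
  simpa [oneSubRPow, sub_eq_add_neg] using h

theorem oneSubRPow_half_sq : oneSubRPow (1 / 2) ^ 2 = 1 - X := by
  rw [sq, ← oneSubRPow_add, add_halves, oneSubRPow_one]

theorem oneSubRPow_neg_half_sq_mul : oneSubRPow (-(1 / 2)) ^ 2 * (1 - X) = 1 := by
  rw [← oneSubRPow_half_sq, ← mul_pow, ← oneSubRPow_add, neg_add_cancel, oneSubRPow_zero, one_pow]

theorem constantCoeff_oneSubRPow (a : ℝ) : constantCoeff (oneSubRPow a) = 1 := by
  simp [oneSubRPow, ← coeff_zero_eq_constantCoeff_apply, coeff_rescale, binomialSeries_coeff]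

theorem coeff_oneSubRPow_neg (a : ℝ) (n : ℕ) :
    coeff n (oneSubRPow (-a)) = Ring.multichoose a n := by
  rw [oneSubRPow, coeff_rescale, binomialSeries_coeff, Ring.choose_neg, ← Ring.multichoose_eq,
    smul_eq_mul, mul_one, Units.smul_def, zsmul_eq_mul, Int.cast_negOnePow_natCast, ← mul_assoc,
    ← mul_pow, neg_one_mul, neg_neg, one_pow, one_mul]

theorem hasSumAt_oneSubRPow (a : ℝ) {r : ℝ} (hr : |r| < 1) :
    HasSumAt (oneSubRPow a) r ((1 - r) ^ a) := by
  have h := (Real.one_div_one_sub_rpow_hasFPowerSeriesOnBall_zero (-a)).hasSum (y := r)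
    (by simpa [enorm_eq_nnnorm] using! hr)
  have hr' : 0 ≤ 1 - r := by linarith [abs_lt.1 hr]
  simpa [HasSumAt, FormalMultilinearSeries.ofScalars_apply_eq, Real.rpow_neg hr',
    ← Ring.multichoose_eq, ← coeff_oneSubRPow_neg, mul_comm] using h

theorem isEquivalent_coeff_rescale_oneSubRPow_neg_mul {a ρ r v : ℝ} {T : ℝ⟦X⟧}
    (ha : ∀ m : ℕ, a ≠ -m) (hρ : ρ ≠ 0) (hr : |ρ| < r)
    (hT : Summable fun n => ‖coeff n T‖ * r ^ n) (hTv : HasSumAt T ρ v) (hv : v ≠ 0) :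
    (fun n => coeff n (rescale ρ⁻¹ (oneSubRPow (-a)) * T)) ~[atTop]
      fun n : ℕ => v / Real.Gamma a * (n : ℝ) ^ (a - 1) * ρ⁻¹ ^ n := by
  have hcoeff : ∀ n, coeff n (rescale ρ⁻¹ (oneSubRPow (-a))) = ρ⁻¹ ^ n * Ring.multichoose a n :=
    fun n => by rw [coeff_rescale, coeff_oneSubRPow_neg]
  have hne : ∀ n, coeff n (rescale ρ⁻¹ (oneSubRPow (-a))) ≠ 0 := fun n => by
    rw [hcoeff]
    exact mul_ne_zero (pow_ne_zero n (inv_ne_zero hρ)) (multichoose_ne_zero ha n)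
  have hratio : Tendsto (fun n => coeff n (rescale ρ⁻¹ (oneSubRPow (-a))) /
      coeff (n + 1) (rescale ρ⁻¹ (oneSubRPow (-a)))) atTop (𝓝 ρ) := by
    have h := (tendsto_multichoose_div_succ ha).const_mul ρ
    rw [mul_one] at h
    refine h.congr fun n => ?_
    rw [hcoeff, hcoeff, pow_succ]
    field_simp
  have hbender := tendsto_coeff_mul_div_coeff hr (.of_forall hne) hratio hT hTv
  have hequiv := ((isEquivalent_const_iff_tendsto hv).2 hbender).mul
    ((IsEquivalent.refl (u := fun n : ℕ => ρ⁻¹ ^ n)).mul (isEquivalent_multichoose ha))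
  refine (hequiv.congr_left (.of_eq ?_)).congr_right (.of_eq ?_)
  · ext n
    rw [Pi.mul_apply, Pi.mul_apply, ← hcoeff, div_mul_cancel₀ _ (hne n)]
  · ext n
    simp only [Pi.mul_apply, Function.const_apply]
    ring

end BinomialSeries

section SingularityAnalysis

/-- The dominant singularity of the generating functions: the root of `x² - 3x + 1` of least
modulus. -/
noncomputable def singularity : ℝ := (3 - √5) / 2

theorem singularity_quadratic : singularity ^ 2 - 3 * singularity + 1 = 0 := by
  have h5 : √5 ^ 2 = (5 : ℝ) := Real.sq_sqrt (by norm_num)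
  rw [singularity]
  linear_combination h5 / 4

theorem singularity_pos : 0 < singularity := by
  have h : √5 < 3 := (Real.sqrt_lt' (by norm_num)).2 (by norm_num)
  rw [singularity]
  linarith

theorem fifteen_div_seven_lt_sqrt_five : 15 / 7 < √5 := (Real.lt_sqrt (by norm_num)).2 (by norm_num)

theorem singularity_lt_half : singularity < 1 / 2 := by
  have h := fifteen_div_seven_lt_sqrt_five
  rw [singularity]
  linarith

theorem inv_singularity : singularity⁻¹ = (3 + √5) / 2 := by
  refine inv_eq_of_mul_eq_one_right ?_
  have h5 : √5 ^ 2 = (5 : ℝ) := Real.sq_sqrt (by norm_num)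
  rw [singularity]
  linear_combination -h5 / 4

/-- The factor of `sqrtDisc⁻¹` that is analytic in the unit disc: since
`(x² + x + 1)(x² - 3x + 1) = (1 - x / ρ) (1 - ρ x) (1 - x³) / (1 - x)` for `ρ = singularity`, it is
`((1 - ρ x) (1 - x³) / (1 - x)) ^ (-1 / 2)`. -/
noncomputable def regularFactor : ℝ⟦X⟧ :=
  rescale singularity (oneSubRPow (-(1 / 2))) *
    (oneSubRPow (1 / 2) * expand 3 three_ne_zero (oneSubRPow (-(1 / 2))))

theorem constantCoeff_rescale {R : Type*} [CommSemiring R] (a : R) (f : R⟦X⟧) :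
    constantCoeff (rescale a f) = constantCoeff f := by
  rw [← coeff_zero_eq_constantCoeff_apply, coeff_rescale, pow_zero, one_mul,
    coeff_zero_eq_constantCoeff_apply]

theorem discriminant_mul_one_sub_X :
    ((X ^ 2 + X + 1) * (X ^ 2 - 3 * X + 1) * (1 - X) : ℝ⟦X⟧) =
      (1 - C singularity⁻¹ * X) * (1 - C singularity * X) * (1 - X ^ 3) := by
  have hsum : C singularity⁻¹ + C singularity = (3 : ℝ⟦X⟧) := by
    rw [← map_add, inv_singularity, singularity, ← map_ofNat C]
    ring_nf
  have hprod : C singularity⁻¹ * C singularity = (1 : ℝ⟦X⟧) := by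
    rw [← map_mul, inv_mul_cancel₀ singularity_pos.ne', map_one]
  linear_combination (1 - X ^ 3) * (X * hsum - X ^ 2 * hprod)

theorem eq_one_of_sq_eq_one {R : Type*} [CommRing R] [IsDomain R] [NeZero (2 : R)] {f : R⟦X⟧}
    (hf : f ^ 2 = 1) (hf₀ : constantCoeff f = 1) : f = 1 := by
  refine (sq_eq_one_iff.1 hf).resolve_right fun h => two_ne_zero (α := R) ?_
  rw [h, map_neg, map_one] at hf₀
  linear_combination -hf₀

theorem sqrtDisc_mul_eq_one :
    sqrtDisc * (rescale singularity⁻¹ (oneSubRPow (-(1 / 2))) * regularFactor) = 1 := by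
  have hroot := oneSubRPow_neg_half_sq_mul
  have hpole := congrArg (rescale singularity⁻¹) hroot
  have hconj := congrArg (rescale singularity) hroot
  have hcube := congrArg (expand 3 three_ne_zero) hroot
  simp only [map_mul, map_sub, map_one, map_pow, rescale_X, expand_X] at hpole hconj hcube
  refine eq_one_of_sq_eq_one ?_ ?_
  · rw [regularFactor]
    generalize rescale singularity⁻¹ (oneSubRPow (-(1 / 2))) = P at *
    generalize rescale singularity (oneSubRPow (-(1 / 2))) = Q at *
    generalize expand 3 three_ne_zero (oneSubRPow (-(1 / 2))) = E at *
    calc (sqrtDisc * (P * (Q * (oneSubRPow (1 / 2) * E)))) ^ 2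
        = sqrtDisc ^ 2 * oneSubRPow (1 / 2) ^ 2 * (P ^ 2 * Q ^ 2 * E ^ 2) := by ring
      _ = (P ^ 2 * (1 - C singularity⁻¹ * X)) * (Q ^ 2 * (1 - C singularity * X)) *
            (E ^ 2 * (1 - X ^ 3)) := by
          rw [sqrtDisc_sq, oneSubRPow_half_sq, discriminant_mul_one_sub_X]
          ring
      _ = 1 := by rw [hpole, hconj, hcube, one_mul, one_mul]
  · simp only [regularFactor, map_mul, constantCoeff_sqrtDisc, constantCoeff_rescale,
      constantCoeff_oneSubRPow, constantCoeff_expand, mul_one]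

theorem hasSumAt_regularFactor {r : ℝ} (hr₀ : 0 ≤ r) (hr₁ : r < 1) :
    HasSumAt regularFactor r ((1 - singularity * r) ^ (-(1 / 2) : ℝ) *
      ((1 - r) ^ (1 / 2 : ℝ) * (1 - r ^ 3) ^ (-(1 / 2) : ℝ))) := by
  have hρ := singularity_pos
  have hρ' := singularity_lt_half
  refine (HasSumAt.rescale (hasSumAt_oneSubRPow _ ?_)).mul ((hasSumAt_oneSubRPow _ ?_).mul
    (HasSumAt.expand _ (hasSumAt_oneSubRPow _ ?_)))
  · rw [abs_of_nonneg (by positivity)]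
    nlinarith
  · rwa [abs_of_nonneg hr₀]
  · rw [abs_of_nonneg (by positivity)]
    exact pow_lt_one₀ hr₀ hr₁ three_ne_zero

/-- The polynomial `(1 + 2x² - x³) / 2`, the numerator over `sqrtDisc` of the generating function of
the weight `1 + #U`, up to the polynomial `(1 - x) / 2`. -/
noncomputable def halfNumerator : Polynomial ℝ :=
  Polynomial.C (1 / 2) * (1 + 2 * Polynomial.X ^ 2 - Polynomial.X ^ 3)

theorem weightGF_closedPaths_upsWeight_eq :
    weightGF closedPaths upsWeight =
      rescale singularity⁻¹ (oneSubRPow (-(1 / 2))) * (regularFactor * (halfNumerator : ℝ⟦X⟧)) +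
        C (1 / 2) * (1 - X) := by
  have hinv := sqrtDisc_mul_eq_one
  have hgf := two_mul_sqrtDisc_mul_weightGF_upsWeight (R := ℝ)
  have hhalf : C (1 / 2 : ℝ) * 2 = 1 := by
    rw [← map_ofNat C 2, ← map_mul]
    norm_num
  have hnum : (halfNumerator : ℝ⟦X⟧) = C (1 / 2) * (1 + 2 * X ^ 2 - X ^ 3) := by
    simp only [halfNumerator, Polynomial.coe_mul, Polynomial.coe_C, Polynomial.coe_sub,
      Polynomial.coe_add, Polynomial.coe_one, Polynomial.coe_pow, Polynomial.coe_X]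
    rw [← map_ofNat Polynomial.C 2, Polynomial.coe_C, map_ofNat]
  rw [hnum, ← mul_assoc]
  generalize rescale singularity⁻¹ (oneSubRPow (-(1 / 2))) * regularFactor = I at *
  linear_combination C (1 / 2) * I * hgf +
    (C (1 / 2) * (1 - X) - C (1 / 2) * 2 * weightGF closedPaths upsWeight) * hinv -
    weightGF closedPaths upsWeight * hhalf

theorem halfNumerator_eval_singularity : halfNumerator.eval singularity = (√5 - 1) / 2 := by
  have hquad := singularity_quadratic
  have hs : √5 = 3 - 2 * singularity := by rw [singularity]; ring
  simp only [halfNumerator, Polynomial.eval_mul, Polynomial.eval_C, Polynomial.eval_sub,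
    Polynomial.eval_add, Polynomial.eval_one, Polynomial.eval_ofNat, Polynomial.eval_pow,
    Polynomial.eval_X]
  rw [hs]
  linear_combination -(1 / 2) * (singularity + 1) * hquad

theorem amplitude_eq :
    (1 - singularity * singularity) ^ (-(1 / 2) : ℝ) *
      ((1 - singularity) ^ (1 / 2 : ℝ) * (1 - singularity ^ 3) ^ (-(1 / 2) : ℝ)) *
        halfNumerator.eval singularity = (√5 - 1) / (2 * √(14 * √5 - 30)) := by
  have hρ := singularity_pos
  have hρ' := singularity_lt_half
  have ha : 0 < 1 - singularity * singularity := by nlinarith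
  have hc : 0 < 1 - singularity ^ 3 :=
    sub_pos.2 (pow_lt_one₀ hρ.le (by linarith) three_ne_zero)
  have hprod : (1 - singularity * singularity) * (1 - singularity ^ 3) =
      (14 * √5 - 30) * (1 - singularity) := by
    have hs : √5 = 3 - 2 * singularity := by rw [singularity]; ring
    rw [hs]
    linear_combination (singularity ^ 3 + 3 * singularity ^ 2 + 7 * singularity - 11) *
      singularity_quadratic
  have hd : 0 < 14 * √5 - 30 := by linarith [fifteen_div_seven_lt_sqrt_five]
  have hsqrt := congrArg Real.sqrt hprod
  rw [Real.sqrt_mul ha.le, Real.sqrt_mul hd.le] at hsqrt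
  rw [halfNumerator_eval_singularity, Real.rpow_neg ha.le, Real.rpow_neg hc.le,
    ← Real.sqrt_eq_rpow, ← Real.sqrt_eq_rpow, ← Real.sqrt_eq_rpow]
  have ha' := (Real.sqrt_pos.2 ha).ne'
  have hc' := (Real.sqrt_pos.2 hc).ne'
  have hd' := (Real.sqrt_pos.2 hd).ne'
  generalize √(1 - singularity * singularity) = a, √(1 - singularity) = b,
    √(1 - singularity ^ 3) = c, √(14 * √5 - 30) = d at *
  field_simp
  linear_combination -(√5 - 1) * hsqrt

theorem isEquivalent_coeff_weightGF_closedPaths_upsWeight :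
    (fun n => coeff n (weightGF closedPaths (upsWeight : List Step → ℝ))) ~[atTop] fun n : ℕ =>
      (√5 - 1) / (2 * √(Real.pi * n) * √(14 * √5 - 30)) * ((3 + √5) / 2) ^ n := by
  have hρ := singularity_pos
  have hρ' := singularity_lt_half
  have hhalf : ∀ m : ℕ, (1 / 2 : ℝ) ≠ -m := fun m => by
    have : (0 : ℝ) ≤ m := m.cast_nonneg
    linarith
  have hT {r : ℝ} (hr₀ : 0 ≤ r) (hr₁ : r < 1) :=
    (hasSumAt_regularFactor hr₀ hr₁).mul (hasSumAt_coe halfNumerator r)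
  have hsummable := (hT one_half_pos.le one_half_lt_one).summable.norm
  have hval := hT hρ.le (hρ'.trans one_half_lt_one)
  rw [amplitude_eq] at hval
  simp only [norm_mul, norm_pow, Real.norm_of_nonneg one_half_pos.le] at hsummable
  have hne : (√5 - 1) / (2 * √(14 * √5 - 30)) ≠ 0 := by
    have h5 := fifteen_div_seven_lt_sqrt_five
    exact (div_pos (by linarith) (mul_pos two_pos (Real.sqrt_pos.2 (by linarith)))).ne'
  refine ((isEquivalent_coeff_rescale_oneSubRPow_neg_mul hhalf hρ.ne'
    (by rwa [abs_of_pos hρ]) hsummable hval hne).congr_left ?_).congr_right (.of_eq ?_)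
  · filter_upwards [eventually_gt_atTop 1] with n hn
    obtain ⟨m, rfl⟩ := Nat.exists_eq_add_of_le' hn
    simp [weightGF_closedPaths_upsWeight_eq, coeff_X]
  · ext n
    rw [Real.Gamma_one_half_eq, inv_singularity, Real.sqrt_mul Real.pi_nonneg,
      Real.sqrt_eq_rpow n, show (1 / 2 - 1 : ℝ) = -(1 / 2) by norm_num,
      Real.rpow_neg n.cast_nonneg]
    field_simp

theorem isEquivalent_natCast_sub (j : ℕ) :
    (fun n : ℕ => ((n - j : ℕ) : ℝ)) ~[atTop] fun n : ℕ => (n : ℝ) := by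
  have h := (isEquivalent_of_tendsto_one
    (tendsto_natCast_div_add_atTop (𝕜 := ℝ) j)).comp_tendsto (tendsto_sub_atTop_nat j)
  refine h.congr_right ?_
  filter_upwards [eventually_ge_atTop j] with n hn
  simp [Nat.cast_sub hn]

theorem popularity_pyramid_isEquivalent {k : ℕ} (hk : 1 ≤ k) :
    (fun n : ℕ => (popularity (pyramid k) n : ℝ)) ~[atTop] fun n : ℕ =>
      (√5 - 1) / (2 * √(Real.pi * n) * √(14 * √5 - 30)) *
        ((3 + √5) / 2) ^ ((n : ℤ) - (k : ℤ) - 1) := by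
  have hshift := isEquivalent_coeff_weightGF_closedPaths_upsWeight.comp_tendsto
    (tendsto_sub_atTop_nat (k + 1))
  have hsqrt : (fun n : ℕ => √(Real.pi * (n - (k + 1) : ℕ))) ~[atTop]
      fun n : ℕ => √(Real.pi * n) := by
    simp only [Real.sqrt_eq_rpow]
    exact ((IsEquivalent.refl (u := fun _ : ℕ => Real.pi)).mul
      (isEquivalent_natCast_sub (k + 1))).rpow
      (fun n => mul_nonneg Real.pi_nonneg n.cast_nonneg)
  have hright := ((IsEquivalent.refl (u := fun _ : ℕ => √5 - 1)).div
    (((IsEquivalent.refl (u := fun _ : ℕ => (2 : ℝ))).mul hsqrt).mul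
      (IsEquivalent.refl (u := fun _ : ℕ => √(14 * √5 - 30))))).mul
    (IsEquivalent.refl (u := fun n : ℕ => ((3 + √5) / 2) ^ (n - (k + 1))))
  refine ((hshift.trans hright).congr_left ?_).congr_right ?_
  · filter_upwards [eventually_ge_atTop (k + 1)] with n hn
    obtain ⟨m, rfl⟩ := Nat.exists_eq_add_of_le' hn
    simp [popularity_pyramid_add hk, weightGF, upsWeight]
  · filter_upwards [eventually_ge_atTop (k + 1)] with n hn
    rw [show (n : ℤ) - k - 1 = (n - (k + 1) : ℕ) by omega, zpow_natCast]
    rfl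

end SingularityAnalysis

end AirPockets

/-- `S` is the formal square root of `(x²+x+1)(x²-3x+1)` with constant term `1`. -/
theorem corollary8 :
    (∃ S : PowerSeries ℝ,
      S ^ 2 = (X ^ 2 + X + 1) * (X ^ 2 - 3 * X + 1) ∧ constantCoeff S = 1 ∧
      ∀ k : ℕ, 1 ≤ k →
        pyramidGF k =
          X ^ (k + 1) * (1 + 2 * X ^ 2 - X ^ 3 + (1 - X) * S) * (2 * S)⁻¹) ∧
    (∀ k n : ℕ, 1 ≤ k → 2 ≤ n →
      popularity (pyramid 1) n = popularity (pyramid k) (n + k - 1)) ∧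
    (∀ k : ℕ, 1 ≤ k →
      (fun n : ℕ => (popularity (pyramid k) n : ℝ)) ~[atTop]
        (fun n : ℕ =>
          (√5 - 1) / (2 * √(Real.pi * n) * √(14 * √5 - 30)) *
            ((3 + √5) / 2) ^ ((n : ℤ) - (k : ℤ) - 1))) :=
  ⟨⟨sqrtDisc, sqrtDisc_sq, constantCoeff_sqrtDisc, fun _ hk => pyramidGF_eq hk⟩,
    fun _ _ hk hn => popularity_pyramid_one_eq hk hn,
    fun _ hk => popularity_pyramid_isEquivalent hk⟩
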